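/- A semigroup is \emph{completely simple} if it has no proper two-sided ideal and has a minimal left ideal and a minimal right ideal (ideals are nonempty). Every completely simple semigroup is a disjoint union of groups and is regarded as an algebra $(S,\cdot,{}^{-1})$, where $x^{-1}$ is the inverse of $x$ in the maximal subgroup containing $x$. With this operation the completely simple semigroups form the variety of semigroups with a unary operation given by the identities $$xx^{-1}x=x,\qquad xx^{-1}=x^{-1}x,\qquad (x^{-1})^{-1}=x,\qquad (xyx)^{-1}(xyx)=x^{-1}x .$$ The free product $S_1\ast S_2$ of completely simple semigroups $S_1,S_2$ is their coproduct in this variety. Let $L_S=\{\cdot,{}^{-1}\}\cup\{s\mid s\in S\}$ be the language with a constant for each element of $S$. An $L_S$-term in variables $x_1,\dots,x_n$ is built from the variables and the constants by products and inversion. A set $Y\subseteq S^n$ is \emph{algebraic} over $S$ if it is the set of solutions in $S^n$ of some (possibly infinite) system of equations $t(x_1,\dots,x_n)=t'(x_1,\dots,x_n)$ between $L_S$-terms. A completely simple semigroup $S$ is an \emph{equational domain} in the language $L_S$ if, for every $n$, the union $Y_1\cup\dots\cup Y_m$ of any finite number $m\ge 1$ of algebraic sets $Y_1,\dots,Y_m\subseteq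 S^n$ is algebraic. \textbf{Corollary.} Let $S_1$ and $S_2$ be completely simple semigroups, not both consisting of a single element. Then their free product $S=S_1\ast S_2$ in the variety of completely simple semigroups is (a completely simple semigroup which is) an equational domain in the language $L_S$. -/

import Mathlib

universe u v w

/-! ### Completely simple semigroups -/

/-- A nonempty subset `I` with `s * a ∈ I` for all `s` and all `a ∈ I`. -/
def IsLeftIdealSet {S : Type u} [Mul S] (I : Set S) : Prop :=
  I.Nonempty ∧ ∀ s a : S, a ∈ I → s * a ∈ I

/-- A nonempty subset `I` with `a * s ∈ I` for all `s` and all `a ∈ I`. -/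
def IsRightIdealSet {S : Type u} [Mul S] (I : Set S) : Prop :=
  I.Nonempty ∧ ∀ s a : S, a ∈ I → a * s ∈ I

/-- A semigroup is completely simple if it is its only two-sided ideal and it has a minimal left
ideal and a minimal right ideal (so, in particular, it is nonempty). -/
structure IsCompletelySimple (S : Type u) [Semigroup S] : Prop where
  eq_univ_of_isIdeal : ∀ I : Set S, IsLeftIdealSet I → IsRightIdealSet I → I = Set.univ
  exists_minimal_left : ∃ L : Set S, Minimal IsLeftIdealSet L
  exists_minimal_right : ∃ R : Set S, Minimal IsRightIdealSet R

/-- The variety of algebras `(S, ·, ⁻¹)` defined by associativity and the four identities below.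
Its nonempty members are exactly the completely simple semigroups, each with the operation of
inversion in its maximal subgroups; see `CSVariety.isCompletelySimple` and
`IsCompletelySimple.exists_csVariety`. -/
class CSVariety (S : Type u) extends Semigroup S, Inv S where
  mul_inv_mul : ∀ x : S, x * x⁻¹ * x = x
  mul_inv_comm : ∀ x : S, x * x⁻¹ = x⁻¹ * x
  inv_inv_eq : ∀ x : S, (x⁻¹)⁻¹ = x
  inv_mul_sandwich : ∀ x y : S, (x * y * x)⁻¹ * (x * y * x) = x⁻¹ * x

/-- In any semigroup, an element has at most one commuting inverse. -/
theorem commuting_inverse_unique {S : Type u} [Semigroup S] {x y z : S}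
    (hy₁ : x * y * x = x) (hy₂ : y * x * y = y) (hy₃ : x * y = y * x)
    (hz₁ : x * z * x = x) (hz₂ : z * x * z = z) (hz₃ : x * z = z * x) : y = z := by
  have h : x * y = x * z := by
    calc x * y = (x * z * x) * y := by rw [hz₁]
      _ = z * (x * y * x) := by rw [hz₃]; simp only [mul_assoc]; rw [hy₃]
      _ = x * z := by rw [hy₁, hz₃]
  calc y = (y * x) * y := hy₂.symm
    _ = (z * x) * y := by rw [← hy₃, h, hz₃]
    _ = z * (x * y) := by rw [mul_assoc]
    _ = z := by rw [h, ← mul_assoc, hz₂]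

namespace CSVariety

variable {S : Type u} [CSVariety S]

theorem inv_mul_inv (x : S) : x⁻¹ * x * x⁻¹ = x⁻¹ := by
  have h := mul_inv_mul (x⁻¹)
  rwa [inv_inv_eq] at h

/-- Every element `a` lies in `S (b a)`. -/
theorem exists_left (a b : S) : ∃ c, c * (b * a) = a :=
  ⟨a * (a * b * a)⁻¹ * a, by
    calc a * (a * b * a)⁻¹ * a * (b * a) = a * ((a * b * a)⁻¹ * (a * b * a)) := by
          simp only [mul_assoc]
      _ = a := by rw [inv_mul_sandwich, ← mul_assoc, mul_inv_mul]⟩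

/-- Every element `a` lies in `(a b) S`. -/
theorem exists_right (a b : S) : ∃ c, a * b * c = a :=
  ⟨a * (a * b * a)⁻¹ * a, by
    calc a * b * (a * (a * b * a)⁻¹ * a) = (a * b * a) * (a * b * a)⁻¹ * a := by
          simp only [mul_assoc]
      _ = a := by rw [mul_inv_comm, inv_mul_sandwich, ← mul_inv_comm, mul_inv_mul]⟩

theorem isCompletelySimple [hS : Nonempty S] : IsCompletelySimple S := by
  obtain ⟨a⟩ := hS
  refine ⟨fun I hl hr => ?_, ⟨Set.range (· * a), ⟨⟨_, a, rfl⟩, ?_⟩, ?_⟩,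
    ⟨Set.range (a * ·), ⟨⟨_, a, rfl⟩, ?_⟩, ?_⟩⟩
  · obtain ⟨b, hb⟩ := hl.1
    refine Set.eq_univ_of_forall fun x => ?_
    obtain ⟨c, hc⟩ := exists_left x b
    rw [← hc]
    exact hl.2 _ _ (hr.2 _ _ hb)
  · rintro s _ ⟨t, rfl⟩
    exact ⟨s * t, mul_assoc s t a⟩
  · rintro I hI hle _ ⟨s, rfl⟩
    obtain ⟨b, hb⟩ := hI.1
    obtain ⟨t, rfl⟩ := hle hb
    obtain ⟨c, hc⟩ := exists_left a t
    have h := hI.2 (s * c) _ hb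
    simpa only [mul_assoc, hc] using h
  · rintro s _ ⟨t, rfl⟩
    exact ⟨t * s, (mul_assoc a t s).symm⟩
  · rintro I hI hle _ ⟨s, rfl⟩
    obtain ⟨b, hb⟩ := hI.1
    obtain ⟨t, rfl⟩ := hle hb
    obtain ⟨c, hc⟩ := exists_right a t
    have h := hI.2 (c * s) _ hb
    simpa only [← mul_assoc, hc] using h

/-- Multiplicative maps between completely simple semigroups preserve inversion. -/
theorem map_inv {T : Type v} [CSVariety T] (f : S →ₙ* T) (x : S) : f x⁻¹ = (f x)⁻¹ := by
  apply commuting_inverse_unique (x := f x)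
  · rw [← map_mul, ← map_mul, mul_inv_mul]
  · rw [← map_mul, ← map_mul, inv_mul_inv]
  · rw [← map_mul, ← map_mul, mul_inv_comm]
  · exact mul_inv_mul _
  · exact inv_mul_inv _
  · exact mul_inv_comm _

end CSVariety

/-- A completely simple semigroup carries an inversion satisfying the identities of the variety. -/
theorem IsCompletelySimple.exists_csVariety {S : Type u} [hS : Semigroup S]
    (h : IsCompletelySimple S) : ∃ V : CSVariety S, V.toSemigroup = hS := by
  obtain ⟨hI, ⟨L, hL, hLmin⟩, ⟨R, hR, hRmin⟩⟩ := h
  have h1 : ∀ x s : S, ∃ c, c * (s * x) = x := by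
    intro x s
    have hx : x ∈ {x | ∃ l ∈ L, ∃ t, l * t = x} := by
      rw [hI {x | ∃ l ∈ L, ∃ t, l * t = x}]
      · trivial
      · refine ⟨?_, ?_⟩
        · obtain ⟨l, hl⟩ := hL.1
          exact ⟨_, l, hl, l, rfl⟩
        · rintro s _ ⟨l, hl, t, rfl⟩
          exact ⟨s * l, hL.2 _ _ hl, t, mul_assoc _ _ _⟩
      · refine ⟨?_, ?_⟩
        · obtain ⟨l, hl⟩ := hL.1
          exact ⟨_, l, hl, l, rfl⟩
        · rintro s _ ⟨l, hl, t, rfl⟩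
          exact ⟨l, hl, t * s, (mul_assoc _ _ _).symm⟩
    obtain ⟨l, hl, t, rfl⟩ := hx
    have hM : IsLeftIdealSet (Set.range (· * (s * l))) := by
      refine ⟨⟨_, l, rfl⟩, ?_⟩
      rintro r _ ⟨t, rfl⟩
      exact ⟨r * t, mul_assoc _ _ _⟩
    have hle : Set.range (· * (s * l)) ≤ L := by
      rintro _ ⟨t, rfl⟩
      exact hL.2 _ _ (hL.2 _ _ hl)
    obtain ⟨c, hc⟩ := hLmin hM hle hl
    refine ⟨c, ?_⟩
    simp only at hc
    rw [← mul_assoc s, ← mul_assoc, hc]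
  have h2 : ∀ x s : S, ∃ c, x * s * c = x := by
    intro x s
    have hx : x ∈ {x | ∃ r ∈ R, ∃ t, t * r = x} := by
      rw [hI {x | ∃ r ∈ R, ∃ t, t * r = x}]
      · trivial
      · refine ⟨?_, ?_⟩
        · obtain ⟨r, hr⟩ := hR.1
          exact ⟨_, r, hr, r, rfl⟩
        · rintro s _ ⟨r, hr, t, rfl⟩
          exact ⟨r, hr, s * t, mul_assoc _ _ _⟩
      · refine ⟨?_, ?_⟩
        · obtain ⟨r, hr⟩ := hR.1
          exact ⟨_, r, hr, r, rfl⟩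
        · rintro s _ ⟨r, hr, t, rfl⟩
          exact ⟨r * s, hR.2 _ _ hr, t, (mul_assoc _ _ _).symm⟩
    obtain ⟨r, hr, t, rfl⟩ := hx
    have hM : IsRightIdealSet (Set.range (r * s * ·)) := by
      refine ⟨⟨_, r, rfl⟩, ?_⟩
      rintro q _ ⟨t, rfl⟩
      exact ⟨t * q, (mul_assoc _ _ _).symm⟩
    have hle : Set.range (r * s * ·) ≤ R := by
      rintro _ ⟨t, rfl⟩
      exact hR.2 _ _ (hR.2 _ _ hr)
    obtain ⟨c, hc⟩ := hRmin hM hle hr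
    refine ⟨c, ?_⟩
    simp only at hc
    rw [mul_assoc t, mul_assoc, hc]
  have h3 : ∀ x : S, ∃ y, x * y * x = x ∧ y * x * y = y ∧ x * y = y * x := by
    intro x
    obtain ⟨u, hu⟩ := h1 x x
    obtain ⟨v, hv⟩ := h2 x x
    have he : u * x = x * v := by
      calc u * x = u * (x * x * v) := by rw [hv]
        _ = u * (x * x) * v := by simp only [mul_assoc]
        _ = x * v := by rw [hu]
    have e1 : u * x * x = x := by rw [mul_assoc, hu]
    have e2 : x * (u * x) = x := by rw [he, ← mul_assoc, hv]
    have e3 : x * (u * x * v) = u * x := by rw [← mul_assoc, e2, he]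
    have e4 : u * x * v * x = u * x := by
      rw [mul_assoc u, ← he, mul_assoc, e1]
    refine ⟨u * x * v, ?_, ?_, ?_⟩
    · rw [e3, e1]
    · rw [e4, ← mul_assoc, mul_assoc u x (u * x), e2]
    · rw [e3, e4]
  choose inv i1 i2 i3 using h3
  refine ⟨{ hS with
    inv := inv
    mul_inv_mul := i1
    mul_inv_comm := i3
    inv_inv_eq := fun x => ?_
    inv_mul_sandwich := fun x y => ?_ }, rfl⟩
  · exact commuting_inverse_unique (i1 (inv x)) (i2 (inv x)) (i3 (inv x)) (i2 x) (i1 x) (i3 x).symm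
  · obtain ⟨c, hc⟩ := h1 x (x * y)
    have hw := i1 (x * y * x)
    have hcomm := i3 (x * y * x)
    have hwx : x * y * x * (inv x * x) = x * y * x := by
      rw [mul_assoc (x * y) x, ← mul_assoc x (inv x), i1]
    have hex : inv x * x * (x * y * x) = x * y * x := by
      rw [← i3]
      simp only [← mul_assoc]
      rw [i1]
    generalize x * y * x = w at *
    have a1 : inv x * x * (inv w * w) = inv w * w := by
      rw [← hcomm, ← mul_assoc, hex]
    have a2 : inv x * x * (inv w * w) = inv x * x := by
      have : x * (inv w * w) = x := by
        conv_lhs => rw [← hc]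
        rw [mul_assoc c, ← mul_assoc w, hw, hc]
      rw [mul_assoc, this]
    exact a1.symm.trans a2

/-! ### Terms in the language `{·, ⁻¹}` -/

/-- Terms in the language `{·, ⁻¹}` built from the letters in `α`. -/
inductive InvTerm (α : Type u) : Type u
  | letter : α → InvTerm α
  | mul : InvTerm α → InvTerm α → InvTerm α
  | inv : InvTerm α → InvTerm α

/-- The value of a term under an assignment of values to the letters. -/
def InvTerm.eval {α : Type u} {S : Type v} [Mul S] [Inv S] (f : α → S) : InvTerm α → S
  | .letter a => f a
  | .mul t s => t.eval f * s.eval f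
  | .inv t => (t.eval f)⁻¹

/-! ### Free products in the variety of completely simple semigroups -/

/-- The least congruence on the terms with letters in `S₁ ⊔ S₂` that contains all instances of the
identities of completely simple semigroups and the multiplication tables of `S₁` and `S₂`. (The
inverses of the elements of completely simple `S₁` and `S₂` are then preserved automatically.) -/
inductive CSFreeProduct.Rel (S₁ : Type u) (S₂ : Type v) [Semigroup S₁] [Semigroup S₂] :
    InvTerm (S₁ ⊕ S₂) → InvTerm (S₁ ⊕ S₂) → Prop
  | refl (t) : Rel S₁ S₂ t t
  | symm {t s} : Rel S₁ S₂ t s → Rel S₁ S₂ s t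
  | trans {t s r} : Rel S₁ S₂ t s → Rel S₁ S₂ s r → Rel S₁ S₂ t r
  | mul {t t' s s'} : Rel S₁ S₂ t t' → Rel S₁ S₂ s s' → Rel S₁ S₂ (.mul t s) (.mul t' s')
  | inv {t t'} : Rel S₁ S₂ t t' → Rel S₁ S₂ (.inv t) (.inv t')
  | mul_assoc (t s r) : Rel S₁ S₂ (.mul (.mul t s) r) (.mul t (.mul s r))
  | mul_inv_mul (t) : Rel S₁ S₂ (.mul (.mul t (.inv t)) t) t
  | mul_inv_comm (t) : Rel S₁ S₂ (.mul t (.inv t)) (.mul (.inv t) t)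
  | inv_inv (t) : Rel S₁ S₂ (.inv (.inv t)) t
  | inv_mul_sandwich (t s) :
      Rel S₁ S₂ (.mul (.inv (.mul (.mul t s) t)) (.mul (.mul t s) t)) (.mul (.inv t) t)
  | inl_mul (a b : S₁) :
      Rel S₁ S₂ (.letter (.inl (a * b))) (.mul (.letter (.inl a)) (.letter (.inl b)))
  | inr_mul (a b : S₂) :
      Rel S₁ S₂ (.letter (.inr (a * b))) (.mul (.letter (.inr a)) (.letter (.inr b)))

/-- The congruence as a setoid. -/
def CSFreeProduct.setoid (S₁ : Type u) (S₂ : Type v) [Semigroup S₁] [Semigroup S₂] :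
    Setoid (InvTerm (S₁ ⊕ S₂)) :=
  ⟨CSFreeProduct.Rel S₁ S₂, CSFreeProduct.Rel.refl, CSFreeProduct.Rel.symm,
    CSFreeProduct.Rel.trans⟩

/-- The free product `S₁ ∗ S₂` in the variety of completely simple semigroups. -/
def CSFreeProduct (S₁ : Type u) (S₂ : Type v) [Semigroup S₁] [Semigroup S₂] : Type (max u v) :=
  Quotient (CSFreeProduct.setoid S₁ S₂)

namespace CSFreeProduct

variable {S₁ : Type u} {S₂ : Type v} [Semigroup S₁] [Semigroup S₂]

/-- The class of a term. -/
def mk (t : InvTerm (S₁ ⊕ S₂)) : CSFreeProduct S₁ S₂ :=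
  Quotient.mk (setoid S₁ S₂) t

/-- The product and the inverse of classes of terms are induced by those of terms. -/
instance : CSVariety (CSFreeProduct S₁ S₂) where
  mul := Quotient.map₂ InvTerm.mul fun _ _ h _ _ h' => Rel.mul h h'
  inv := Quotient.map InvTerm.inv fun _ _ h => Rel.inv h
  mul_assoc := by
    rintro ⟨t⟩ ⟨s⟩ ⟨r⟩
    exact Quotient.sound (Rel.mul_assoc t s r)
  mul_inv_mul := by
    rintro ⟨t⟩
    exact Quotient.sound (Rel.mul_inv_mul t)
  mul_inv_comm := by
    rintro ⟨t⟩
    exact Quotient.sound (Rel.mul_inv_comm t)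
  inv_inv_eq := by
    rintro ⟨t⟩
    exact Quotient.sound (Rel.inv_inv t)
  inv_mul_sandwich := by
    rintro ⟨t⟩ ⟨s⟩
    exact Quotient.sound (Rel.inv_mul_sandwich t s)

/-- The canonical map `S₁ → S₁ ∗ S₂`. -/
def inl : S₁ →ₙ* CSFreeProduct S₁ S₂ where
  toFun a := mk (.letter (.inl a))
  map_mul' a b := Quotient.sound (Rel.inl_mul a b)

/-- The canonical map `S₂ → S₁ ∗ S₂`. -/
def inr : S₂ →ₙ* CSFreeProduct S₁ S₂ where
  toFun a := mk (.letter (.inr a))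
  map_mul' a b := Quotient.sound (Rel.inr_mul a b)

theorem isCompletelySimple (h₁ : IsCompletelySimple S₁) :
    IsCompletelySimple (CSFreeProduct S₁ S₂) := by
  obtain ⟨L, hL, -⟩ := h₁.exists_minimal_left
  obtain ⟨a, -⟩ := hL.1
  have : Nonempty (CSFreeProduct S₁ S₂) := ⟨inl a⟩
  exact CSVariety.isCompletelySimple

/-- The universal property of the coproduct among completely simple semigroups. -/
theorem existsUnique_lift {T : Type w} [hT : Semigroup T] (h : IsCompletelySimple T)
    (f₁ : S₁ →ₙ* T) (f₂ : S₂ →ₙ* T) :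
    ∃! F : CSFreeProduct S₁ S₂ →ₙ* T,
      (∀ a, F (inl a) = f₁ a) ∧ (∀ b, F (inr b) = f₂ b) := by
  obtain ⟨V, rfl⟩ := h.exists_csVariety
  have hrel : ∀ t s, Rel S₁ S₂ t s →
      t.eval (Sum.elim f₁ f₂) = s.eval (Sum.elim f₁ f₂) := by
    intro t s hts
    induction hts with
    | refl t => rfl
    | symm _ ih => exact ih.symm
    | trans _ _ ih ih' => exact ih.trans ih'
    | mul _ _ ih ih' => simp only [InvTerm.eval, ih, ih']
    | inv _ ih => simp only [InvTerm.eval, ih]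
    | mul_assoc t s r => exact _root_.mul_assoc _ _ _
    | mul_inv_mul t => exact CSVariety.mul_inv_mul _
    | mul_inv_comm t => exact CSVariety.mul_inv_comm _
    | inv_inv t => exact CSVariety.inv_inv_eq _
    | inv_mul_sandwich t s => exact CSVariety.inv_mul_sandwich _ _
    | inl_mul a b => exact map_mul f₁ a b
    | inr_mul a b => exact map_mul f₂ a b
  let F : CSFreeProduct S₁ S₂ →ₙ* T :=
    { toFun := Quotient.lift (InvTerm.eval (Sum.elim f₁ f₂)) hrel
      map_mul' := by
        rintro ⟨t⟩ ⟨s⟩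
        rfl }
  refine ⟨F, ⟨fun _ => rfl, fun _ => rfl⟩, ?_⟩
  rintro F' ⟨h1, h2⟩
  refine MulHom.ext ?_
  rintro ⟨t⟩
  change F' (mk t) = F (mk t)
  induction t with
  | letter a =>
    cases a with
    | inl a => exact h1 a
    | inr b => exact h2 b
  | mul t s iht ihs =>
    have h := map_mul F' (mk t) (mk s)
    rw [iht, ihs, ← map_mul] at h
    exact h
  | inv t ih =>
    have h := CSVariety.map_inv F' (mk t)
    rw [ih, ← CSVariety.map_inv] at h
    exact h

end CSFreeProduct

/-! ### Algebraic sets and equational domains -/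

/-- `L_S`-terms in `n` variables: the letters are the variables `x₁, …, xₙ` (left summand) and the
constants `s ∈ S` (right summand). -/
abbrev LTerm (S : Type u) (n : ℕ) : Type u := InvTerm (Fin n ⊕ S)

/-- The value of an `L_S`-term at a point of `Sⁿ`. -/
def LTerm.value {S : Type u} [Mul S] [Inv S] {n : ℕ} (t : LTerm S n) (p : Fin n → S) : S :=
  t.eval (Sum.elim p id)

/-- `V_S(E)`: all points of `Sⁿ` that satisfy every equation `t = s` of the system `E`. -/
def solutionSet {S : Type u} [Mul S] [Inv S] {n : ℕ} (E : Set (LTerm S n × LTerm S n)) :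
    Set (Fin n → S) :=
  {p | ∀ e ∈ E, e.1.value p = e.2.value p}

/-- `Y ⊆ Sⁿ` is algebraic over `L_S` if it is the solution set of some (possibly infinite) system
of equations over `L_S` in `n` variables. -/
def IsAlgebraicSet {S : Type u} [Mul S] [Inv S] {n : ℕ} (Y : Set (Fin n → S)) : Prop :=
  ∃ E : Set (LTerm S n × LTerm S n), solutionSet E = Y

/-- `S` is an equational domain in the language `L_S`: for every `n`, the union of any finite
family `Y₁, …, Yₘ` (`m ≥ 1`) of algebraic subsets of `Sⁿ` is algebraic. -/
def IsEquationalDomain (S : Type u) [Mul S] [Inv S] : Prop :=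
  ∀ (n : ℕ) (C : Set (Set (Fin n → S))), C.Finite → C.Nonempty →
    (∀ Y ∈ C, IsAlgebraicSet Y) → IsAlgebraicSet (⋃₀ C)

/-! ### A criterion for equational domains -/

/-! Fix an idempotent `e`; then `e * S * e` is a group. In any context `c, d`, an equation `x = y`
becomes the statement that the quotient `cornerQuotient e c d x y` is the identity `e` of this
group. If translations separate points, `x = y` is equivalent to all these statements together. If
moreover the group has no zero divisors (nontrivial elements `a`, `b` with `a` commuting with every
conjugate of `b`), then `x = y ∨ z = w` says exactly that all quotients of the first pair commute
with all conjugates of those of the second. This is a system of equations, so unions of algebraic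
sets are algebraic (`isEquationalDomain_of_noZeroDivisorsAt`).

Both conditions are verified on an explicit model of the free product. By `reesMulEquiv` each factor
is a Rees matrix semigroup whose sandwich matrix has a base row and a base column of ones. The free
product is the Rees matrix semigroup with a block matrix: the two given matrices on the diagonal and
free generators off it, apart from one lower entry normalized to `1`
(`CSFreeProduct.nonempty_mulEquiv`). Its group is a free product of both groups and a free group.
The free entries make rows and columns non-proportional, hence separation. One free generator splits
off as an infinite cyclic factor with nontrivial complement, and a normal form argument in the free
product of groups excludes zero divisors. -/

theorem CSVariety.inv_mul_of_mem_corner {S : Type u} [CSVariety S] {e x : S} (he : e * e = e)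
    (h₁ : e * x = x) (h₂ : x * e = x) : x⁻¹ * x = e := by
  -- The fourth identity with `e` as outer letter: the sandwich `e * x * e` is `x` itself.
  have h := inv_mul_sandwich e x
  have hi : e⁻¹ = e := commuting_inverse_unique (mul_inv_mul e)
    (inv_mul_inv e) (mul_inv_comm e) (by rw [he, he]) (by rw [he, he]) rfl
  rwa [h₁, h₂, hi, he] at h

theorem CSVariety.mul_inv_of_mem_corner {S : Type u} [CSVariety S] {e x : S} (he : e * e = e)
    (h₁ : e * x = x) (h₂ : x * e = x) : x * x⁻¹ = e := by
  rw [mul_inv_comm, inv_mul_of_mem_corner he h₁ h₂]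

theorem CSVariety.mul_inv_corner {S : Type u} [CSVariety S] {e x : S} (he : e * e = e)
    (h₁ : e * x = x) (h₂ : x * e = x) : e * x⁻¹ = x⁻¹ := by
  rw [← inv_mul_of_mem_corner he h₁ h₂, inv_mul_inv]

theorem CSVariety.inv_mul_corner {S : Type u} [CSVariety S] {e x : S} (he : e * e = e)
    (h₁ : e * x = x) (h₂ : x * e = x) : x⁻¹ * e = x⁻¹ := by
  rw [← mul_inv_of_mem_corner he h₁ h₂, ← mul_assoc, inv_mul_inv]

/-- `S` separates its points by the translations `x ↦ c * x * d`. -/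
def SeparatedByTranslations (S : Type u) [Mul S] : Prop :=
  ∀ x y : S, (∀ c d : S, c * x * d = c * y * d) → x = y

/-- In the maximal subgroup `e * S * e`, if `a` commutes with all conjugates of `b`, then `a` or `b`
is the identity `e`. -/
def NoZeroDivisorsAt {S : Type u} [Mul S] [Inv S] (e : S) : Prop :=
  ∀ a b : S, e * a = a → a * e = a → e * b = b → b * e = b →
    (∀ g : S, e * g = g → g * e = g → a * (g * b * g⁻¹) = g * b * g⁻¹ * a) → a = e ∨ b = e

/-- Separating contexts can be routed through `e`, because `c` lies in `S * (e * c)` and `d` in `(d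
* e) * S`; the separation then happens inside the group `e * S * e`. -/
theorem SeparatedByTranslations.exists_ne {S : Type u} [CSVariety S]
    (hS : SeparatedByTranslations S) (e : S) {x y : S} (hxy : x ≠ y) :
    ∃ c d : S, e * c * x * (d * e) ≠ e * c * y * (d * e) := by
  by_contra! h
  refine hxy (hS x y fun c d => ?_)
  obtain ⟨s, hs⟩ := CSVariety.exists_left c e
  obtain ⟨t, ht⟩ := CSVariety.exists_right d e
  rw [← hs, ← ht]
  have h' := h c d
  calc s * (e * c) * x * (d * e * t) = s * (e * c * x * (d * e)) * t := by simp only [mul_assoc]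
    _ = s * (e * c) * y * (d * e * t) := by rw [h']; simp only [mul_assoc]

/-- The element of `e * S * e` measuring the difference of `x` and `y` in the context `c, d`. -/
def cornerQuotient {S : Type u} [Mul S] [Inv S] (e c d x y : S) : S :=
  e * c * x * (d * e) * (e * c * y * (d * e))⁻¹

section cornerQuotient

variable {S : Type u} [CSVariety S] {e : S}

theorem cornerQuotient_self (he : e * e = e) (c d x : S) : cornerQuotient e c d x x = e := by
  refine CSVariety.mul_inv_of_mem_corner he ?_ ?_
  · simp only [← mul_assoc, he]
  · simp only [mul_assoc, he]

theorem mul_cornerQuotient (he : e * e = e) (c d x y : S) :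
    e * cornerQuotient e c d x y = cornerQuotient e c d x y := by
  simp only [cornerQuotient, ← mul_assoc, he]

theorem cornerQuotient_mul (he : e * e = e) (c d x y : S) :
    cornerQuotient e c d x y * e = cornerQuotient e c d x y := by
  rw [cornerQuotient, mul_assoc, CSVariety.inv_mul_corner he]
  · simp only [← mul_assoc, he]
  · simp only [mul_assoc, he]

theorem eq_of_cornerQuotient_eq (he : e * e = e) {c d x y : S}
    (h : cornerQuotient e c d x y = e) : e * c * x * (d * e) = e * c * y * (d * e) := by
  have h₁ : e * (e * c * y * (d * e)) = e * c * y * (d * e) := by simp only [← mul_assoc, he]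
  have h₂ : e * c * y * (d * e) * e = e * c * y * (d * e) := by simp only [mul_assoc, he]
  have h₃ : e * c * x * (d * e) * e = e * c * x * (d * e) := by simp only [mul_assoc, he]
  calc e * c * x * (d * e)
      = e * c * x * (d * e) * ((e * c * y * (d * e))⁻¹ * (e * c * y * (d * e))) := by
        rw [CSVariety.inv_mul_of_mem_corner he h₁ h₂, h₃]
    _ = cornerQuotient e c d x y * (e * c * y * (d * e)) := by
        rw [cornerQuotient, mul_assoc (e * c * x * (d * e))]
    _ = e * c * y * (d * e) := by rw [h, h₁]

/-- The disjunction turns into a conjunction of equations. An equality makes the corresponding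
quotient equal to `e`, which commutes with everything in the group; two inequalities yield two
quotients different from `e`, and these cannot satisfy all the commutations. -/
theorem eq_or_eq_iff_forall_commute (he : e * e = e) (hS : SeparatedByTranslations S)
    (hz : NoZeroDivisorsAt e) (x y z w : S) :
    (x = y ∨ z = w) ↔ ∀ c d c' d' g : S, e * g = g → g * e = g →
      cornerQuotient e c d x y * (g * cornerQuotient e c' d' z w * g⁻¹) =
        g * cornerQuotient e c' d' z w * g⁻¹ * cornerQuotient e c d x y := by
  constructor
  · rintro (rfl | rfl) c d c' d' g h₁ h₂
    · rw [cornerQuotient_self he, mul_assoc (g * _), CSVariety.inv_mul_corner he h₁ h₂]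
      simp only [← mul_assoc, h₁]
    · rw [cornerQuotient_self he, h₂, CSVariety.mul_inv_of_mem_corner he h₁ h₂,
        mul_cornerQuotient he, cornerQuotient_mul he]
  · intro h
    by_contra! hne
    obtain ⟨c, d, hcd⟩ := hS.exists_ne e hne.1
    obtain ⟨c', d', hcd'⟩ := hS.exists_ne e hne.2
    rcases hz _ _ (mul_cornerQuotient he c d x y) (cornerQuotient_mul he c d x y)
      (mul_cornerQuotient he c' d' z w) (cornerQuotient_mul he c' d' z w)
      (fun g h₁ h₂ => h c d c' d' g h₁ h₂) with h' | h'
    · exact hcd (eq_of_cornerQuotient_eq he h')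
    · exact hcd' (eq_of_cornerQuotient_eq he h')

end cornerQuotient

/-- The term with value `cornerQuotient e c d t s`. -/
def cornerTerm {S : Type u} {n : ℕ} (e c d : S) (t s : LTerm S n) : LTerm S n :=
  let k : S → LTerm S n := fun a => .letter (.inr a)
  .mul (.mul (.mul (.mul (k e) (k c)) t) (.mul (k d) (k e)))
    (.inv (.mul (.mul (.mul (k e) (k c)) s) (.mul (k d) (k e))))

/-- The term `g * t * g⁻¹`. -/
def conjTerm {S : Type u} {n : ℕ} (g : S) (t : LTerm S n) : LTerm S n :=
  .mul (.mul (.letter (.inr g)) t) (.inv (.letter (.inr g)))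

theorem IsAlgebraicSet.union {S : Type u} [CSVariety S] {e : S} (he : e * e = e)
    (hS : SeparatedByTranslations S) (hz : NoZeroDivisorsAt e) {n : ℕ} {Y Z : Set (Fin n → S)}
    (hY : IsAlgebraicSet Y) (hZ : IsAlgebraicSet Z) : IsAlgebraicSet (Y ∪ Z) := by
  obtain ⟨E, rfl⟩ := hY
  obtain ⟨E', rfl⟩ := hZ
  -- One commutation equation for each pair of equations and each choice of contexts and conjugator.
  -- The system may be infinite, so the quantifiers over constants are harmless.
  refine ⟨{q | ∃ u ∈ E, ∃ v ∈ E', ∃ c d c' d' g : S, e * g = g ∧ g * e = g ∧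
    q = (.mul (cornerTerm e c d u.1 u.2) (conjTerm g (cornerTerm e c' d' v.1 v.2)),
      .mul (conjTerm g (cornerTerm e c' d' v.1 v.2)) (cornerTerm e c d u.1 u.2))}, ?_⟩
  ext p
  constructor
  · intro hp
    by_contra hpn
    simp only [Set.mem_union, not_or, solutionSet, Set.mem_ofPred_eq, not_forall] at hpn
    obtain ⟨⟨u, hu, hune⟩, v, hv, hvne⟩ := hpn
    rcases (eq_or_eq_iff_forall_commute he hS hz _ _ _ _).2
      (fun c d c' d' g h₁ h₂ => hp _ ⟨u, hu, v, hv, c, d, c', d', g, h₁, h₂, rfl⟩) with h | h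
    · exact hune h
    · exact hvne h
  · rintro hp _ ⟨u, hu, v, hv, c, d, c', d', g, h₁, h₂, rfl⟩
    exact (eq_or_eq_iff_forall_commute he hS hz (u.1.value p) (u.2.value p) (v.1.value p)
      (v.2.value p)).1 (hp.imp (fun h => h u hu) fun h => h v hv) c d c' d' g h₁ h₂

theorem isEquationalDomain_of_noZeroDivisorsAt {S : Type u} [CSVariety S] {e : S}
    (he : e * e = e) (hS : SeparatedByTranslations S) (hz : NoZeroDivisorsAt e) :
    IsEquationalDomain S := by
  intro n C hC
  induction C, hC using Set.Finite.induction_on with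
  | empty => exact fun h => absurd h Set.not_nonempty_empty
  | @insert Y C _ _ ih =>
    intro _ hall
    rcases C.eq_empty_or_nonempty with rfl | hne
    · simpa using hall
    · rw [Set.sUnion_insert]
      exact (hall Y (Set.mem_insert _ _)).union he hS hz
        (ih hne fun Z hZ => hall Z (Set.mem_insert_of_mem _ hZ))

/-! ### Invariance of the two conditions under isomorphism. -/

section transport

variable {S : Type u} {T : Type v} [CSVariety S] [CSVariety T] (φ : S ≃* T)

include φ in
theorem SeparatedByTranslations.of_mulEquiv (hT : SeparatedByTranslations T) :
    SeparatedByTranslations S := by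
  intro x y h
  refine φ.injective (hT _ _ fun c d => ?_)
  have h' := congrArg φ (h (φ.symm c) (φ.symm d))
  simpa using h'

theorem NoZeroDivisorsAt.of_mulEquiv {e : S} (h : NoZeroDivisorsAt (φ e)) :
    NoZeroDivisorsAt e := by
  intro a b a₁ a₂ b₁ b₂ hg
  have key := h (φ a) (φ b) (by rw [← map_mul, a₁]) (by rw [← map_mul, a₂])
    (by rw [← map_mul, b₁]) (by rw [← map_mul, b₂]) fun g g₁ g₂ => by
      have := congrArg φ (hg (φ.symm g) (φ.injective (by simpa using g₁))
        (φ.injective (by simpa using g₂)))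
      have hi : φ (φ.symm g)⁻¹ = g⁻¹ := by
        have := CSVariety.map_inv (φ : S →ₙ* T) (φ.symm g)
        simpa using this
      simpa [hi] using this
  exact key.imp (fun h => φ.injective h) fun h => φ.injective h

end transport

/-! ### Free products of groups without zero divisors -/

/-- A group in which two nontrivial elements never have all their conjugates commuting. -/
def GroupNoZeroDivisors (G : Type u) [Group G] : Prop :=
  ∀ a b : G, (∀ g : G, a * (g * b * g⁻¹) = g * b * g⁻¹ * a) → a = 1 ∨ b = 1

theorem GroupNoZeroDivisors.of_mulEquiv {G : Type u} {H : Type v} [Group G] [Group H]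
    (φ : G ≃* H) (h : GroupNoZeroDivisors H) : GroupNoZeroDivisors G := by
  intro a b hab
  have key := h (φ a) (φ b) fun g => by
    have := congrArg φ (hab (φ.symm g))
    simpa using this
  simpa using key

namespace Monoid.CoprodI

variable {ι : Type u} {G : ι → Type v} [∀ i, Group (G i)]

/-- Conjugating by a letter `z` of `G k` puts letters of `G k` at both ends. If one end is already
in `G k`, it merges with `z` or `z⁻¹` and must not cancel, so `z` has to avoid two elements; this is
why `G k` needs three. -/
theorem NeWord.exists_conj_prod {k : ι} (hk : ∀ x y : G k, ∃ z, z ≠ x ∧ z ≠ y)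
    {i j : ι} (w : NeWord G i j) :
    ∃ (u : CoprodI G) (w' : NeWord G k k), w'.prod = u * w.prod * u⁻¹ := by
  by_cases hi : i = k
  · subst hi
    by_cases hj : j = i
    · subst hj
      exact ⟨1, w, by simp⟩
    · obtain ⟨z, hz₁, hz₂⟩ := hk 1 w.head⁻¹
      have hz : z * w.head ≠ 1 := fun h => hz₂ (eq_inv_of_mul_eq_one_left h)
      refine ⟨of z, .append (w.mulHead z hz) hj (.singleton z⁻¹ (inv_ne_one.2 hz₁)), ?_⟩
      simp
  · by_cases hj : j = k
    · subst hj
      obtain ⟨z, hz₁, hz₂⟩ := hk 1 w.last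
      have hz : z * w.inv.head ≠ 1 := fun h => hz₂ (by simpa using eq_inv_of_mul_eq_one_left h)
      -- Inverting twice turns multiplication of the head by `z` into multiplication of the last
      -- letter by `z⁻¹`.
      refine ⟨of z, .append (.singleton z hz₁) (Ne.symm hi) (w.inv.mulHead z hz).inv, ?_⟩
      simp [mul_assoc]
    · obtain ⟨z, hz, -⟩ := hk 1 1
      refine ⟨of z, .append (.append (.singleton z hz) (Ne.symm hi) w) hj
        (.singleton z⁻¹ (inv_ne_one.2 hz)), ?_⟩
      simp

theorem exists_conj_eq_prod {k : ι} (hk : ∀ x y : G k, ∃ z, z ≠ x ∧ z ≠ y) {a : CoprodI G}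
    (ha : a ≠ 1) : ∃ (u : CoprodI G) (w : NeWord G k k), w.prod = u * a * u⁻¹ := by
  classical
  have hw : Word.equiv a ≠ Word.empty := fun h => ha (by
    rw [← Word.equiv.symm_apply_apply a, h]
    rfl)
  obtain ⟨i, j, w, hw'⟩ := NeWord.of_word _ hw
  have hp : w.prod = a := by
    rw [NeWord.prod, hw']
    exact Word.equiv.symm_apply_apply a
  rw [← hp]
  exact w.exists_conj_prod hk

/-- Up to conjugation `a` is a reduced word with both ends in `G k`, and `b`, conjugated once more
by a letter of `G l`, has both ends in `G l`. Their two products are reduced words with first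
letters in different factors, so they do not commute. -/
theorem groupNoZeroDivisors {k l : ι} (hkl : k ≠ l) (hk : ∀ x y : G k, ∃ z, z ≠ x ∧ z ≠ y)
    (hl : ∃ t : G l, t ≠ 1) : GroupNoZeroDivisors (CoprodI G) := by
  classical
  intro a b hab
  by_contra! h
  obtain ⟨u, w, hw⟩ := exists_conj_eq_prod hk h.1
  obtain ⟨v, w', hw'⟩ := exists_conj_eq_prod hk h.2
  obtain ⟨t, ht⟩ := hl
  obtain ⟨w'', hprod⟩ : ∃ w'' : NeWord G l l, w''.prod = of t * v * b * (of t * v)⁻¹ :=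
    ⟨.append (.append (.singleton t ht) hkl.symm w') hkl (.singleton t⁻¹ (inv_ne_one.2 ht)), by
      simp [hw', mul_assoc]⟩
  have heq : (NeWord.append w hkl w'').prod = (NeWord.append w'' hkl.symm w).prod := by
    -- This conjugator, followed by conjugation with `u`, makes the hypothesis say that `w` and
    -- `w''` commute.
    have := congrArg (fun x => u * x * u⁻¹) (hab (u⁻¹ * (of t * v)))
    rw [NeWord.append_prod, NeWord.append_prod, hprod, hw]
    simpa [mul_assoc] using this
  have hword := congrArg (fun x : Word G => x.toList.head?) (Word.equiv.symm.injective
    (show Word.equiv.symm (NeWord.append w hkl w'').toWord =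
      Word.equiv.symm (NeWord.append w'' hkl.symm w).toWord from heq))
  have h₁ := (NeWord.append w hkl w'').toList_head?
  have h₂ := (NeWord.append w'' hkl.symm w).toList_head?
  have h₃ := h₁.symm.trans (hword.trans h₂)
  exact hkl (congrArg Sigma.fst (Option.some.inj h₃))

end Monoid.CoprodI

namespace Monoid.Coprod

/-- The family of two groups, lifted to a common universe. -/
def boolFamily (A : Type u) (B : Type v) : Bool → Type (max u v)
  | true => ULift.{v} A
  | false => ULift.{u} B

variable (A : Type u) (B : Type v) [Group A] [Group B]

instance : ∀ b, Group (boolFamily A B b)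
  | true => inferInstanceAs (Group (ULift.{v} A))
  | false => inferInstanceAs (Group (ULift.{u} B))

/-- The inclusion of the first group. -/
def toBoolFamilyTrue : A ≃* boolFamily A B true :=
  (MulEquiv.ulift : ULift.{v} A ≃* A).symm

/-- The inclusion of the second group. -/
def toBoolFamilyFalse : B ≃* boolFamily A B false :=
  (MulEquiv.ulift : ULift.{u} B ≃* B).symm

/-- The components of the map out of `Monoid.CoprodI (boolFamily A B)`. -/
def ofBoolFamily : ∀ b, boolFamily A B b →* Monoid.Coprod A B
  | true => inl.comp (toBoolFamilyTrue A B).symm.toMonoidHom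
  | false => inr.comp (toBoolFamilyFalse A B).symm.toMonoidHom

/-- A binary free product of groups as a free product of a family indexed by `Bool`. -/
def mulEquivCoprodI : Monoid.Coprod A B ≃* Monoid.CoprodI (boolFamily A B) :=
  MonoidHom.toMulEquiv
    (lift (Monoid.CoprodI.of.comp (toBoolFamilyTrue A B).toMonoidHom)
      (Monoid.CoprodI.of.comp (toBoolFamilyFalse A B).toMonoidHom))
    (Monoid.CoprodI.lift (ofBoolFamily A B))
    (by
      ext x
      · simp [ofBoolFamily]
      · simp [ofBoolFamily])
    (by
      ext b x
      cases b
      · simp [ofBoolFamily]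
      · simp [ofBoolFamily])

variable {A B}

/-- Here `B` supplies the three elements and `A` the nontrivial outer letter. -/
theorem groupNoZeroDivisors [Nontrivial A] (hB : ∀ x y : B, ∃ z, z ≠ x ∧ z ≠ y) :
    GroupNoZeroDivisors (Monoid.Coprod A B) := by
  refine .of_mulEquiv (mulEquivCoprodI A B)
    (Monoid.CoprodI.groupNoZeroDivisors (k := false) (l := true) (by simp) ?_ ?_)
  · intro x y
    obtain ⟨z, hx, hy⟩ := hB ((toBoolFamilyFalse A B).symm x) ((toBoolFamilyFalse A B).symm y)
    exact ⟨toBoolFamilyFalse A B z, fun h => hx (by simp [← h]), fun h => hy (by simp [← h])⟩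
  · obtain ⟨t, ht⟩ := exists_ne (1 : A)
    exact ⟨toBoolFamilyTrue A B t, fun h => ht (by simpa using h)⟩

end Monoid.Coprod

/-! ### Rees matrix semigroups -/

/-- The Rees matrix semigroup over a group `G` with sandwich matrix `P`. -/
@[ext]
structure ReesMatrix {G I Λ : Type*} (P : Λ → I → G) where
  /-- The row index. -/
  row : I
  /-- The group component. -/
  val : G
  /-- The column index. -/
  col : Λ

namespace ReesMatrix

variable {G I Λ : Type*} [Group G] {P : Λ → I → G}

instance : Mul (ReesMatrix P) :=
  ⟨fun x y => ⟨x.row, x.val * P x.col y.row * y.val, y.col⟩⟩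

instance : Inv (ReesMatrix P) :=
  ⟨fun x => ⟨x.row, (P x.col x.row)⁻¹ * x.val⁻¹ * (P x.col x.row)⁻¹, x.col⟩⟩

@[simp]
theorem mk_mul_mk (i j : I) (g h : G) (l m : Λ) :
    (⟨i, g, l⟩ * ⟨j, h, m⟩ : ReesMatrix P) = ⟨i, g * P l j * h, m⟩ :=
  rfl

@[simp]
theorem inv_mk (i : I) (g : G) (l : Λ) :
    (⟨i, g, l⟩⁻¹ : ReesMatrix P) = ⟨i, (P l i)⁻¹ * g⁻¹ * (P l i)⁻¹, l⟩ :=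
  rfl

instance : CSVariety (ReesMatrix P) where
  mul_assoc := by
    rintro ⟨i, g, l⟩ ⟨j, h, m⟩ ⟨k, f, n⟩
    simp [mul_assoc]
  mul_inv_mul := by
    rintro ⟨i, g, l⟩
    simp [mul_assoc]
  mul_inv_comm := by
    rintro ⟨i, g, l⟩
    simp [mul_assoc]
  inv_inv_eq := by
    rintro ⟨i, g, l⟩
    simp [mul_assoc]
  inv_mul_sandwich := by
    rintro ⟨i, g, l⟩ ⟨j, h, m⟩
    simp [mul_assoc]

/-- As the base entry is `1`, the elements with row `i₀` and column `l₀` multiply and invert exactly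
as their components in `G`. -/
theorem noZeroDivisorsAt (hG : GroupNoZeroDivisors G) {i₀ : I} {l₀ : Λ} (h₀ : P l₀ i₀ = 1) :
    NoZeroDivisorsAt (⟨i₀, 1, l₀⟩ : ReesMatrix P) := by
  rintro ⟨i, a, l⟩ ⟨j, b, m⟩ h₁ h₂ h₃ h₄ hg
  obtain rfl : i₀ = i := congrArg row h₁
  obtain rfl : l₀ = l := congrArg col h₂
  obtain rfl : i₀ = j := congrArg row h₃
  obtain rfl : l₀ = m := congrArg col h₄
  have key := hG a b fun g => by
    simpa [h₀] using congrArg val (hg ⟨i₀, g, l₀⟩ (by simp [h₀]) (by simp [h₀]))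
  simpa using key

/-- If no two rows and no two columns of the sandwich matrix are proportional, translations separate
the points. -/
theorem separatedByTranslations [Nonempty I] [Nonempty Λ]
    (hI : ∀ (i j : I) (t : G), (∀ l, P l i = P l j * t) → i = j)
    (hΛ : ∀ (l m : Λ) (s : G), (∀ i, P l i = s * P m i) → l = m) :
    SeparatedByTranslations (ReesMatrix P) := by
  rintro ⟨i, g, l⟩ ⟨j, h, m⟩ H
  have H' : ∀ n k, P n i * g * P l k = P n j * h * P m k := fun n k => by
    obtain ⟨i₀⟩ := ‹Nonempty I›
    obtain ⟨l₀⟩ := ‹Nonempty Λ›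
    simpa using congrArg val (H ⟨i₀, 1, n⟩ ⟨k, 1, l₀⟩)
  obtain ⟨i₀⟩ := ‹Nonempty I›
  obtain ⟨l₀⟩ := ‹Nonempty Λ›
  -- The factor is found by solving `H' n i₀` for `P n i`; it does not depend on `n`.
  obtain rfl : i = j := hI i j (h * P m i₀ * (g * P l i₀)⁻¹) fun n => by
    rw [← mul_assoc, ← mul_assoc, ← H']
    group
  obtain rfl : l = m := hΛ l m ((P l₀ i * g)⁻¹ * (P l₀ i * h)) fun k => by
    rw [mul_assoc, ← H']
    group
  have := H' l₀ i₀
  simp_all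

end ReesMatrix

/-! ### The Rees coordinates of a completely simple semigroup -/

section ReesCoordinates

variable {S : Type u} [CSVariety S]

/-- The maximal subgroup `e * S * e`. -/
@[ext]
structure MaximalSubgroup (e : S) where
  /-- The underlying element. -/
  val : S
  mul_val : e * val = val
  val_mul : val * e = val

/-- The idempotents in `S * e`. -/
@[ext]
structure LeftIdempotent (e : S) where
  /-- The underlying element. -/
  val : S
  idem : val * val = val
  val_mul : val * e = val

/-- The idempotents in `e * S`. -/
@[ext]
structure RightIdempotent (e : S) where
  /-- The underlying element. -/
  val : S
  idem : val * val = val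
  mul_val : e * val = val

theorem CSVariety.idempotent_eq_of_mem_corner {e x : S} (he : e * e = e) (h₁ : e * x = x)
    (h₂ : x * e = x) (hx : x * x = x) : x = e := by
  rw [← inv_mul_of_mem_corner he h₁ h₂]
  conv_lhs => rw [← h₁, ← inv_mul_of_mem_corner he h₁ h₂, mul_assoc, hx]

/-- The product is an idempotent of the group `e * S * e`. This and its dual give the base row and
column of ones in the sandwich matrix. -/
theorem LeftIdempotent.mul_eq {e : S} (he : e * e = e) (i : LeftIdempotent e) :
    e * i.val = e := by
  refine CSVariety.idempotent_eq_of_mem_corner he (by rw [← mul_assoc, he])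
    (by rw [mul_assoc, i.val_mul]) ?_
  rw [mul_assoc, ← mul_assoc i.val, i.val_mul, i.idem]

theorem RightIdempotent.mul_eq {e : S} (he : e * e = e) (l : RightIdempotent e) :
    l.val * e = e := by
  refine CSVariety.idempotent_eq_of_mem_corner he (by rw [← mul_assoc, l.mul_val])
    (by rw [mul_assoc, he]) ?_
  rw [mul_assoc, ← mul_assoc e, l.mul_val, ← mul_assoc, l.idem]

/-- Put `h = (e * x * e)⁻¹`. Then `h * x * h = h`, so `x * h * x` is fixed by right multiplication
by `h * x`. By the sandwich identity `x⁻¹ * x` is fixed as well, and hence so is `x`. -/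
theorem CSVariety.mul_corner_inv_mul {e : S} (he : e * e = e) (x : S) :
    x * (e * x * e)⁻¹ * x = x := by
  have h₁ : e * (e * x * e) = e * x * e := by simp only [← mul_assoc, he]
  have h₂ : e * x * e * e = e * x * e := by simp only [mul_assoc, he]
  have a₁ := mul_inv_corner he h₁ h₂
  have a₂ := inv_mul_corner he h₁ h₂
  have a₃ := inv_mul_of_mem_corner he h₁ h₂
  have hh : (e * x * e)⁻¹ * x * (e * x * e)⁻¹ = (e * x * e)⁻¹ := by
    calc (e * x * e)⁻¹ * x * (e * x * e)⁻¹
        = ((e * x * e)⁻¹ * e) * x * (e * (e * x * e)⁻¹) := by rw [a₁, a₂]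
      _ = ((e * x * e)⁻¹ * (e * x * e)) * (e * x * e)⁻¹ := by simp only [mul_assoc]
      _ = (e * x * e)⁻¹ := by rw [a₃, a₁]
  generalize (e * x * e)⁻¹ = h at *
  have hs := inv_mul_sandwich x h
  have hw : x * h * x * (h * x) = x * h * x := by
    calc x * h * x * (h * x) = x * (h * x * h) * x := by simp only [mul_assoc]
      _ = x * h * x := by rw [hh]
  have hf : x⁻¹ * x * (h * x) = x⁻¹ * x := by
    rw [← hs, mul_assoc, hw]
  calc x * h * x = x * (x⁻¹ * x * (h * x)) := by
        rw [← mul_assoc x, ← mul_assoc x, mul_inv_mul, mul_assoc]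
    _ = x := by rw [hf, ← mul_assoc, mul_inv_mul]

variable {e : S} (he : e * e = e)

/-- The group structure on `e * S * e`. -/
abbrev MaximalSubgroup.group : Group (MaximalSubgroup e) where
  mul x y := ⟨x.val * y.val, by rw [← mul_assoc, x.mul_val], by rw [mul_assoc, y.val_mul]⟩
  one := ⟨e, he, he⟩
  inv x := ⟨x.val⁻¹, CSVariety.mul_inv_corner he x.mul_val x.val_mul,
    CSVariety.inv_mul_corner he x.mul_val x.val_mul⟩
  mul_assoc x y z := MaximalSubgroup.ext (mul_assoc _ _ _)
  one_mul x := MaximalSubgroup.ext x.mul_val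
  mul_one x := MaximalSubgroup.ext x.val_mul
  inv_mul_cancel x := MaximalSubgroup.ext (CSVariety.inv_mul_of_mem_corner he x.mul_val x.val_mul)

/-- The sandwich matrix of `S`: the product of the idempotents in `e * S` and those in `S * e`. -/
def sandwich (e : S) (l : RightIdempotent e) (i : LeftIdempotent e) : MaximalSubgroup e :=
  ⟨l.val * i.val, by rw [← mul_assoc, l.mul_val], by rw [mul_assoc, i.val_mul]⟩

/-- The base row index. -/
abbrev LeftIdempotent.base : LeftIdempotent e := ⟨e, he, he⟩

/-- The base column index. -/
abbrev RightIdempotent.base : RightIdempotent e := ⟨e, he, he⟩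

theorem sandwich_base_left (i : LeftIdempotent e) :
    sandwich e (RightIdempotent.base he) i = ⟨e, he, he⟩ :=
  MaximalSubgroup.ext (i.mul_eq he)

theorem sandwich_base_right (l : RightIdempotent e) :
    sandwich e l (LeftIdempotent.base he) = ⟨e, he, he⟩ :=
  MaximalSubgroup.ext (l.mul_eq he)

/-- The Rees coordinates with respect to an idempotent. -/
noncomputable def reesMulEquiv :
    letI := MaximalSubgroup.group he
    ReesMatrix (sandwich e) ≃* S :=
  letI := MaximalSubgroup.group he
  MulEquiv.ofBijective
    ({ toFun := fun x => x.row.val * x.val.val * x.col.val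
       map_mul' := fun x y => by
        change x.row.val * (x.val.val * (x.col.val * y.row.val) * y.val.val) * y.col.val = _
        simp only [mul_assoc] } : ReesMatrix (sandwich e) →ₙ* S) <| by
    constructor
    · rintro ⟨i, g, l⟩ ⟨j, h, m⟩ H
      replace H : i.val * g.val * l.val = j.val * h.val * m.val := H
      -- Multiplication by `e` on both sides removes the outer idempotents and leaves the group
      -- component.
      have hg : g = h := by
        have := congrArg (fun x => e * x * e) H
        simp only [← mul_assoc, i.mul_eq he, j.mul_eq he] at this
        simp only [mul_assoc, l.mul_eq he, m.mul_eq he] at this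
        rw [g.val_mul, h.val_mul, g.mul_val, h.mul_val] at this
        exact MaximalSubgroup.ext this
      subst hg
      have hi : i = j := by
        have := congrArg (fun x => x * (e * g.val⁻¹)) H
        simp only [← mul_assoc] at this
        rw [mul_assoc _ l.val, mul_assoc _ m.val, l.mul_eq he, m.mul_eq he, mul_assoc i.val,
          mul_assoc j.val, g.val_mul, mul_assoc, mul_assoc,
          CSVariety.mul_inv_of_mem_corner he g.mul_val g.val_mul, i.val_mul, j.val_mul] at this
        exact LeftIdempotent.ext this
      have hl : l = m := by
        have := congrArg (fun x => g.val⁻¹ * (e * x)) H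
        simp only [← mul_assoc] at this
        rw [mul_assoc _ e i.val, mul_assoc _ e j.val, i.mul_eq he, j.mul_eq he, mul_assoc _ e,
          g.mul_val, CSVariety.inv_mul_of_mem_corner he g.mul_val g.val_mul, l.mul_val,
          m.mul_val] at this
        exact RightIdempotent.ext this
      rw [hi, hl]
    · intro x
      have h₁ : e * (e * x * e) = e * x * e := by simp only [← mul_assoc, he]
      have h₂ : e * x * e * e = e * x * e := by simp only [mul_assoc, he]
      have a₁ := CSVariety.mul_inv_corner he h₁ h₂
      have a₂ := CSVariety.inv_mul_corner he h₁ h₂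
      have a₃ := CSVariety.mul_corner_inv_mul he x
      -- The factorization `x = (x * h) * (e * x * e) * (h * x)` with `h = (e * x * e)⁻¹`; the outer
      -- factors are idempotent since `x * h * x = x`.
      refine ⟨⟨⟨x * (e * x * e)⁻¹, ?_, ?_⟩, ⟨e * x * e, h₁, h₂⟩, ⟨(e * x * e)⁻¹ * x, ?_, ?_⟩⟩, ?_⟩
      · rw [← mul_assoc, a₃]
      · rw [mul_assoc, a₂]
      · rw [mul_assoc, ← mul_assoc x, a₃]
      · rw [← mul_assoc, a₁]
      · change x * (e * x * e)⁻¹ * (e * x * e) * ((e * x * e)⁻¹ * x) = x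
        rw [mul_assoc x, CSVariety.inv_mul_of_mem_corner he h₁ h₂, mul_assoc x, ← mul_assoc e, a₁,
          ← mul_assoc, a₃]

end ReesCoordinates

/-! ### The structure of free products of Rees matrix semigroups -/

/-- The elements `a` and `f * e` are mutually inverse links between `e` and `f`: `y ↦ a * y * (f *
e)` carries the group at `f` into the group at `e`. -/
theorem CSVariety.exists_linking {S : Type u} [CSVariety S] {e f : S} (he : e * e = e)
    (hf : f * f = f) : ∃ a : S, e * a = a ∧ a * (f * e) = e ∧ f * e * a = f := by
  have h₁ : e * (e * f * e) = e * f * e := by simp only [← mul_assoc, he]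
  have h₂ : e * f * e * e = e * f * e := by simp only [mul_assoc, he]
  have a₁ := mul_inv_corner he h₁ h₂
  have a₂ := inv_mul_corner he h₁ h₂
  refine ⟨(e * f * e)⁻¹ * f, by rw [← mul_assoc, a₁], ?_, ?_⟩
  · rw [mul_assoc, ← mul_assoc f, hf, ← a₂, mul_assoc, ← mul_assoc e,
      inv_mul_of_mem_corner he h₁ h₂]
  · rw [mul_assoc f, ← mul_assoc e, a₁, ← mul_assoc, mul_corner_inv_mul he]

/-- The free generators of the structure group of a free product that are not the distinguished one:
the entries of the sandwich matrix outside the diagonal blocks, except for the base entries. -/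
abbrev CrossIndex {I₁ I₂ Λ₁ Λ₂ : Type*} (i₁ : I₁) (i₂ : I₂) (l₁ : Λ₁) (l₂ : Λ₂) : Type _ :=
  {q : Λ₁ × I₂ // q ≠ (l₁, i₂)} ⊕ {q : Λ₂ × I₁ // q ≠ (l₂, i₁)}

/-- The structure group of a free product of completely simple semigroups. -/
def StructureGroup (G₁ G₂ : Type*) [Group G₁] [Group G₂] {I₁ I₂ Λ₁ Λ₂ : Type*} (i₁ : I₁) (i₂ : I₂)
    (l₁ : Λ₁) (l₂ : Λ₂) : Type _ :=
  Monoid.Coprod (Monoid.Coprod (Monoid.Coprod G₁ G₂) (FreeGroup (CrossIndex i₁ i₂ l₁ l₂)))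
    (FreeGroup Unit)

namespace StructureGroup

section basic

variable {G₁ G₂ : Type*} [Group G₁] [Group G₂] {I₁ I₂ Λ₁ Λ₂ : Type*} (i₁ : I₁) (i₂ : I₂)
  (l₁ : Λ₁) (l₂ : Λ₂)

instance : Group (StructureGroup G₁ G₂ i₁ i₂ l₁ l₂) :=
  inferInstanceAs (Group (Monoid.Coprod (Monoid.Coprod (Monoid.Coprod G₁ G₂)
    (FreeGroup (CrossIndex i₁ i₂ l₁ l₂))) (FreeGroup Unit)))

/-- The inclusion of the first group. -/
def inl : G₁ →* StructureGroup G₁ G₂ i₁ i₂ l₁ l₂ :=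
  Monoid.Coprod.inl.comp (Monoid.Coprod.inl.comp Monoid.Coprod.inl)

/-- The inclusion of the second group. -/
def inr : G₂ →* StructureGroup G₁ G₂ i₁ i₂ l₁ l₂ :=
  Monoid.Coprod.inl.comp (Monoid.Coprod.inl.comp Monoid.Coprod.inr)

open Classical in
/-- The free generators indexed by the upper right block. -/
noncomputable def upper (l : Λ₁) (i : I₂) : StructureGroup G₁ G₂ i₁ i₂ l₁ l₂ :=
  if h : (l, i) = (l₁, i₂) then Monoid.Coprod.inr (FreeGroup.of ())
  else Monoid.Coprod.inl (Monoid.Coprod.inr (FreeGroup.of (.inl ⟨(l, i), h⟩)))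

open Classical in
/-- The free generators indexed by the lower left block, with the base entry `1`. -/
noncomputable def lower (l : Λ₂) (i : I₁) : StructureGroup G₁ G₂ i₁ i₂ l₁ l₂ :=
  if h : (l, i) = (l₂, i₁) then 1
  else Monoid.Coprod.inl (Monoid.Coprod.inr (FreeGroup.of (.inr ⟨(l, i), h⟩)))

theorem upper_base : upper (G₁ := G₁) (G₂ := G₂) i₁ i₂ l₁ l₂ l₁ i₂ =
    Monoid.Coprod.inr (FreeGroup.of ()) :=
  dif_pos rfl

variable {i₁ i₂ l₁ l₂} in
theorem upper_of_ne (q : {q : Λ₁ × I₂ // q ≠ (l₁, i₂)}) :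
    upper (G₁ := G₁) (G₂ := G₂) i₁ i₂ l₁ l₂ q.1.1 q.1.2 =
      Monoid.Coprod.inl (Monoid.Coprod.inr (FreeGroup.of (.inl q))) :=
  dif_neg q.2

@[simp]
theorem lower_base : lower (G₁ := G₁) (G₂ := G₂) i₁ i₂ l₁ l₂ l₂ i₁ = 1 :=
  dif_pos rfl

variable {i₁ i₂ l₁ l₂} in
theorem lower_of_ne (q : {q : Λ₂ × I₁ // q ≠ (l₂, i₁)}) :
    lower (G₁ := G₁) (G₂ := G₂) i₁ i₂ l₁ l₂ q.1.1 q.1.2 =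
      Monoid.Coprod.inl (Monoid.Coprod.inr (FreeGroup.of (.inr q))) :=
  dif_neg q.2

/-- Off-diagonal entries may be prescribed at will, subject only to the normalization `hy`. -/
theorem exists_lift {H : Type*} [Group H] (f₁ : G₁ →* H) (f₂ : G₂ →* H) (x : Λ₁ → I₂ → H)
    (y : Λ₂ → I₁ → H) (hy : y l₂ i₁ = 1) :
    ∃ f : StructureGroup G₁ G₂ i₁ i₂ l₁ l₂ →* H,
      (∀ g, f (inl i₁ i₂ l₁ l₂ g) = f₁ g) ∧ (∀ g, f (inr i₁ i₂ l₁ l₂ g) = f₂ g) ∧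
        (∀ l i, f (upper i₁ i₂ l₁ l₂ l i) = x l i) ∧
          ∀ l i, f (lower i₁ i₂ l₁ l₂ l i) = y l i := by
  let f' : FreeGroup (CrossIndex i₁ i₂ l₁ l₂) →* H :=
    FreeGroup.lift (Sum.elim (fun q => x q.1.1 q.1.2) fun q => y q.1.1 q.1.2)
  have hf' : ∀ q, f' (FreeGroup.of q) = Sum.elim (fun q => x q.1.1 q.1.2)
      (fun q => y q.1.1 q.1.2) q := fun q => by simp [f']
  let f'' : FreeGroup Unit →* H := FreeGroup.lift fun _ => x l₁ i₂
  have hf'' : f'' (FreeGroup.of ()) = x l₁ i₂ := by simp [f'']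
  let f : StructureGroup G₁ G₂ i₁ i₂ l₁ l₂ →* H :=
    Monoid.Coprod.lift (Monoid.Coprod.lift (Monoid.Coprod.lift f₁ f₂) f') f''
  refine ⟨f, fun g => rfl, fun g => rfl, fun l i => ?_, fun l i => ?_⟩
  · by_cases h : (l, i) = (l₁, i₂)
    · obtain ⟨rfl, rfl⟩ := Prod.ext_iff.1 h
      exact (congrArg f (upper_base ..)).trans hf''
    · exact (congrArg f (upper_of_ne ⟨(l, i), h⟩)).trans (hf' _)
  · by_cases h : (l, i) = (l₂, i₁)
    · obtain ⟨rfl, rfl⟩ := Prod.ext_iff.1 h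
      rw [lower_base, map_one, hy]
    · exact (congrArg f (lower_of_ne ⟨(l, i), h⟩)).trans (hf' _)

variable {i₁ i₂ l₁ l₂} in
theorem hom_ext {H : Type*} [Group H] {f f' : StructureGroup G₁ G₂ i₁ i₂ l₁ l₂ →* H}
    (h₁ : ∀ g, f (inl i₁ i₂ l₁ l₂ g) = f' (inl i₁ i₂ l₁ l₂ g))
    (h₂ : ∀ g, f (inr i₁ i₂ l₁ l₂ g) = f' (inr i₁ i₂ l₁ l₂ g))
    (hu : ∀ l i, f (upper i₁ i₂ l₁ l₂ l i) = f' (upper i₁ i₂ l₁ l₂ l i))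
    (hl : ∀ l i, f (lower i₁ i₂ l₁ l₂ l i) = f' (lower i₁ i₂ l₁ l₂ l i)) : f = f' := by
  refine Monoid.Coprod.hom_ext (Monoid.Coprod.hom_ext (Monoid.Coprod.hom_ext
    (MonoidHom.ext h₁) (MonoidHom.ext h₂)) ?_) ?_
  · refine FreeGroup.ext_hom _ _ ?_
    rintro (q | q)
    · have := hu q.1.1 q.1.2
      rwa [upper_of_ne] at this
    · have := hl q.1.1 q.1.2
      rwa [lower_of_ne] at this
  · refine FreeGroup.ext_hom _ _ fun _ => ?_
    have := hu l₁ i₂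
    rwa [upper_base] at this

variable {i₁ i₂ l₁ l₂} in
theorem subgroup_eq_top {H : Subgroup (StructureGroup G₁ G₂ i₁ i₂ l₁ l₂)}
    (h₁ : ∀ g, inl i₁ i₂ l₁ l₂ g ∈ H) (h₂ : ∀ g, inr i₁ i₂ l₁ l₂ g ∈ H)
    (hu : ∀ l i, upper i₁ i₂ l₁ l₂ l i ∈ H) (hl : ∀ l i, lower i₁ i₂ l₁ l₂ l i ∈ H) : H = ⊤ := by
  obtain ⟨f, f₁, f₂, fu, fl⟩ := exists_lift i₁ i₂ l₁ l₂ ((inl i₁ i₂ l₁ l₂).codRestrict H h₁)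
    ((inr i₁ i₂ l₁ l₂).codRestrict H h₂) (fun l i => ⟨_, hu l i⟩) (fun l i => ⟨_, hl l i⟩)
    (Subtype.ext (lower_base ..))
  -- The lift into `H` followed by the inclusion fixes all generators, so every element lies in `H`.
  have hf : H.subtype.comp f = MonoidHom.id _ := hom_ext (fun g => congrArg Subtype.val (f₁ g))
    (fun g => congrArg Subtype.val (f₂ g)) (fun l i => congrArg Subtype.val (fu l i))
    fun l i => congrArg Subtype.val (fl l i)
  refine (Subgroup.eq_top_iff' H).2 fun g => ?_
  have hg : ((f g : H) : StructureGroup G₁ G₂ i₁ i₂ l₁ l₂) = g := DFunLike.congr_fun hf g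
  exact hg ▸ (f g).2

/-- The infinite cyclic factor generated by the base upper entry has at least three elements; the
hypothesis makes the complementary factor nontrivial. -/
theorem noZeroDivisors
    (h : Nontrivial G₁ ∨ Nontrivial G₂ ∨ Nonempty (CrossIndex i₁ i₂ l₁ l₂)) :
    GroupNoZeroDivisors (StructureGroup G₁ G₂ i₁ i₂ l₁ l₂) := by
  have : Nontrivial (Monoid.Coprod (Monoid.Coprod G₁ G₂)
      (FreeGroup (CrossIndex i₁ i₂ l₁ l₂))) := by
    rcases h with h | h | h
    · exact (Monoid.Coprod.inl_injective.comp Monoid.Coprod.inl_injective :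
        Function.Injective ((Monoid.Coprod.inl : _ →* Monoid.Coprod (Monoid.Coprod G₁ G₂)
          (FreeGroup (CrossIndex i₁ i₂ l₁ l₂))) ∘ (Monoid.Coprod.inl : G₁ →* _))).nontrivial
    · exact (Monoid.Coprod.inl_injective.comp Monoid.Coprod.inr_injective :
        Function.Injective ((Monoid.Coprod.inl : _ →* Monoid.Coprod (Monoid.Coprod G₁ G₂)
          (FreeGroup (CrossIndex i₁ i₂ l₁ l₂))) ∘ (Monoid.Coprod.inr : G₂ →* _))).nontrivial
    · exact (Monoid.Coprod.inr_injective (M := Monoid.Coprod G₁ G₂)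
        (N := FreeGroup (CrossIndex i₁ i₂ l₁ l₂))).nontrivial
  refine Monoid.Coprod.groupNoZeroDivisors fun x y => ?_
  obtain ⟨z, hz⟩ := Infinite.exists_notMem_finset ({x, y} : Set (FreeGroup Unit)).toFinite.toFinset
  exact ⟨z, by simpa using hz⟩

end basic

end StructureGroup

/-! ### The block sandwich matrix and its universal property. -/

section freeSandwich

open StructureGroup

variable {G₁ G₂ : Type*} [Group G₁] [Group G₂] {I₁ I₂ Λ₁ Λ₂ : Type*} (i₁ : I₁) (i₂ : I₂)
  (l₁ : Λ₁) (l₂ : Λ₂) (P₁ : Λ₁ → I₁ → G₁) (P₂ : Λ₂ → I₂ → G₂)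

/-- The sandwich matrix of a free product. -/
noncomputable def freeSandwich : Λ₁ ⊕ Λ₂ → I₁ ⊕ I₂ → StructureGroup G₁ G₂ i₁ i₂ l₁ l₂
  | .inl l, .inl i => inl i₁ i₂ l₁ l₂ (P₁ l i)
  | .inl l, .inr i => upper i₁ i₂ l₁ l₂ l i
  | .inr l, .inl i => lower i₁ i₂ l₁ l₂ l i
  | .inr l, .inr i => inr i₁ i₂ l₁ l₂ (P₂ l i)

/-- The inclusion of the first factor. -/
def ReesMatrix.freeInl : ReesMatrix P₁ →ₙ* ReesMatrix (freeSandwich i₁ i₂ l₁ l₂ P₁ P₂) where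
  toFun x := ⟨.inl x.row, inl i₁ i₂ l₁ l₂ x.val, .inl x.col⟩
  map_mul' x y := by
    change (⟨.inl x.row, inl i₁ i₂ l₁ l₂ (x.val * P₁ x.col y.row * y.val), .inl y.col⟩ :
      ReesMatrix (freeSandwich i₁ i₂ l₁ l₂ P₁ P₂)) = _
    simp [freeSandwich]

/-- The inclusion of the second factor. -/
def ReesMatrix.freeInr : ReesMatrix P₂ →ₙ* ReesMatrix (freeSandwich i₁ i₂ l₁ l₂ P₁ P₂) where
  toFun x := ⟨.inr x.row, inr i₁ i₂ l₁ l₂ x.val, .inr x.col⟩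
  map_mul' x y := by
    change (⟨.inr x.row, inr i₁ i₂ l₁ l₂ (x.val * P₂ x.col y.row * y.val), .inr y.col⟩ :
      ReesMatrix (freeSandwich i₁ i₂ l₁ l₂ P₁ P₂)) = _
    simp [freeSandwich]

variable {i₁ i₂ l₁ l₂ P₁ P₂}

theorem freeSandwich_separatedByTranslations (hl₁ : ∀ i, P₁ l₁ i = 1) (hi₁ : ∀ l, P₁ l i₁ = 1)
    (hl₂ : ∀ i, P₂ l₂ i = 1) (hi₂ : ∀ l, P₂ l i₂ = 1) :
    SeparatedByTranslations (ReesMatrix (freeSandwich i₁ i₂ l₁ l₂ P₁ P₂)) := by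
  have : Nonempty (I₁ ⊕ I₂) := ⟨.inl i₁⟩
  have : Nonempty (Λ₁ ⊕ Λ₂) := ⟨.inl l₁⟩
  have hupper : ∀ l i l' i', upper (G₁ := G₁) (G₂ := G₂) i₁ i₂ l₁ l₂ l i =
      upper i₁ i₂ l₁ l₂ l' i' → l = l' ∧ i = i' := by
    intro l i l' i' h
    obtain ⟨f, -, -, hf, -⟩ := exists_lift (G₁ := G₁) (G₂ := G₂) i₁ i₂ l₁ l₂ 1 1
      (fun l i => FreeGroup.of (l, i)) (fun _ _ => 1) rfl
    have := congrArg f h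
    rw [hf, hf] at this
    exact Prod.ext_iff.1 (FreeGroup.of_injective this)
  have hlower : ∀ l i l' i', lower (G₁ := G₁) (G₂ := G₂) i₁ i₂ l₁ l₂ l i =
      lower i₁ i₂ l₁ l₂ l' i' → l = l' ∧ i = i' := by
    intro l i l' i' h
    obtain ⟨f, -, -, -, hf⟩ := exists_lift (G₁ := G₁) (G₂ := G₂) i₁ i₂ l₁ l₂ 1 1
      -- Division by the base generator respects the normalization and keeps the entries distinct.
      (fun _ _ => 1) (fun l i => FreeGroup.of (l, i) * (FreeGroup.of (l₂, i₁))⁻¹) (by simp)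
    have := congrArg f h
    rw [hf, hf] at this
    exact Prod.ext_iff.1 (FreeGroup.of_injective (mul_right_cancel this))
  have hmixed : ∀ l i l' i', upper (G₁ := G₁) (G₂ := G₂) i₁ i₂ l₁ l₂ l i *
      lower i₁ i₂ l₁ l₂ l' i' ≠ 1 := by
    intro l i l' i' h
    obtain ⟨f, -, -, hx, hy⟩ := exists_lift (G₁ := G₁) (G₂ := G₂) i₁ i₂ l₁ l₂ 1 1
      (fun _ _ => FreeGroup.of ()) (fun _ _ => 1) rfl
    have := congrArg f h
    rw [map_mul, hx, hy, map_one, mul_one] at this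
    exact FreeGroup.of_ne_one _ this
  refine ReesMatrix.separatedByTranslations ?_ ?_
  · intro i j t h
    -- For two indices in the same block, the base row with entries `1` forces `t = 1`, and the
    -- other base row, with free entries, identifies them. For indices in different blocks, a
    -- product of an upper and a lower entry would be `1`.
    have h₁ := h (.inl l₁)
    have h₂ := h (.inr l₂)
    rcases i with i | i <;> rcases j with j | j <;>
      simp only [freeSandwich, hl₁, hl₂, map_one, one_mul] at h₁ h₂
    · rw [← h₁, mul_one] at h₂
      rw [(hlower _ _ _ _ h₂).2]
    · exact absurd (h₂ ▸ h₁.symm) (hmixed _ _ _ _)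
    · rw [← h₁] at h₂
      exact absurd (mul_eq_one_comm.1 h₂.symm) (hmixed _ _ _ _)
    · rw [← h₂, mul_one] at h₁
      rw [(hupper _ _ _ _ h₁).2]
  · intro l m s h
    have h₁ := h (.inl i₁)
    have h₂ := h (.inr i₂)
    rcases l with l | l <;> rcases m with m | m <;>
      simp only [freeSandwich, hi₁, hi₂, map_one, mul_one] at h₁ h₂
    · rw [← h₁, one_mul] at h₂
      rw [(hupper _ _ _ _ h₂).1]
    · exact absurd (h₂ ▸ h₁.symm) (hmixed _ _ _ _)
    · rw [← h₁] at h₂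
      exact absurd (mul_eq_one_comm.1 h₂.symm) (hmixed _ _ _ _)
    · rw [← h₂, one_mul] at h₁
      rw [(hlower _ _ _ _ h₁).1]

/-- The map is `⟨i, g, l⟩ ↦ r i * θ g * q l`, with `r` and `q` built from the images of both factors
and `θ` into the group at `e`. It is multiplicative because `q l * r i` is the image under `θ` of
the matrix entry; freeness of the off-diagonal entries allows `θ` to be chosen so. -/
theorem ReesMatrix.free_exists_lift {S : Type*} [CSVariety S] (hl₁ : ∀ i, P₁ l₁ i = 1)
    (hl₂ : ∀ i, P₂ l₂ i = 1)
    (φ₁ : ReesMatrix P₁ →ₙ* S) (φ₂ : ReesMatrix P₂ →ₙ* S) :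
    ∃ Θ : ReesMatrix (freeSandwich i₁ i₂ l₁ l₂ P₁ P₂) →ₙ* S,
      (∀ x, Θ (freeInl i₁ i₂ l₁ l₂ P₁ P₂ x) = φ₁ x) ∧
        ∀ y, Θ (freeInr i₁ i₂ l₁ l₂ P₁ P₂ y) = φ₂ y := by
  set e := φ₁ ⟨i₁, 1, l₁⟩ with e_def
  set f := φ₂ ⟨i₂, 1, l₂⟩ with f_def
  have he : e * e = e := by simp [e_def, ← map_mul, hl₁]
  have hf : f * f = f := by simp [f_def, ← map_mul, hl₂]
  obtain ⟨a, ha, hab, hba⟩ := CSVariety.exists_linking he hf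
  set b := f * e with b_def
  have hbe : b * e = b := by rw [b_def, mul_assoc, he]
  let _ := MaximalSubgroup.group he
  have hmul : ∀ x y : MaximalSubgroup e, (x * y).val = x.val * y.val := fun _ _ => rfl
  have hba' : ∀ x, b * (a * x) = f * x := fun x => by rw [← mul_assoc, hba]
  let θ₁ : G₁ →* MaximalSubgroup e := MonoidHom.mk'
    (fun g => ⟨φ₁ ⟨i₁, g, l₁⟩, by simp [e_def, ← map_mul, hl₁], by simp [e_def, ← map_mul, hl₁]⟩)
    fun g h => MaximalSubgroup.ext (by simp [hmul, ← map_mul, hl₁])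
  let θ₂ : G₂ →* MaximalSubgroup e := MonoidHom.mk'
    (fun g => ⟨a * (φ₂ ⟨i₂, g, l₂⟩ * b), by rw [← mul_assoc, ha], by
      rw [mul_assoc, mul_assoc, hbe]⟩)
    fun g h => MaximalSubgroup.ext (by
      have hgh : φ₂ ⟨i₂, g * h, l₂⟩ = φ₂ ⟨i₂, g, l₂⟩ * (f * φ₂ ⟨i₂, h, l₂⟩) := by
        simp [f_def, ← map_mul, hl₂]
      rw [hmul, hgh]
      simp only [mul_assoc, hba'])
  obtain ⟨θ, h₁, h₂, hu, hl⟩ := StructureGroup.exists_lift i₁ i₂ l₁ l₂ θ₁ θ₂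
    (fun l i => ⟨φ₁ ⟨i₁, 1, l⟩ * (φ₂ ⟨i, 1, l₂⟩ * b), by
      rw [← mul_assoc, e_def, ← map_mul]; simp [hl₁], by rw [mul_assoc, mul_assoc, hbe]⟩)
    (fun l i => ⟨a * φ₂ ⟨i₂, 1, l⟩ * φ₁ ⟨i, 1, l₁⟩, by
      rw [← mul_assoc, ← mul_assoc, ha], by
      rw [mul_assoc, e_def, ← map_mul]; simp [hl₁]⟩)
    -- The base lower entry goes to `a * f * e`, which is `e` by the choice of `a`; so setting that
    -- entry to `1` loses nothing.
    (MaximalSubgroup.ext (by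
      change a * f * e = e
      rw [mul_assoc, ← b_def, hab]))
  let r : I₁ ⊕ I₂ → S := Sum.elim (fun i => φ₁ ⟨i, 1, l₁⟩) fun i => φ₂ ⟨i, 1, l₂⟩ * b
  let q : Λ₁ ⊕ Λ₂ → S := Sum.elim (fun l => φ₁ ⟨i₁, 1, l⟩) fun l => a * φ₂ ⟨i₂, 1, l⟩
  have hqr : ∀ l i, q l * r i = (θ (freeSandwich i₁ i₂ l₁ l₂ P₁ P₂ l i)).val := by
    rintro (l | l) (i | i)
    · simp [q, r, freeSandwich, h₁, θ₁, ← map_mul]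
    · simp [q, r, freeSandwich, hu]
    · simp [q, r, freeSandwich, hl]
    · simp only [q, r, freeSandwich, h₂, θ₂, Sum.elim_inr, MonoidHom.mk'_apply]
      rw [mul_assoc, ← mul_assoc (φ₂ _), ← map_mul]
      simp
  refine ⟨⟨fun x => r x.row * (θ x.val).val * q x.col, ?_⟩, ?_, ?_⟩
  · rintro ⟨i, g, l⟩ ⟨j, h, m⟩
    change r i * (θ (g * _ * h)).val * q m = r i * (θ g).val * q l * (r j * (θ h).val * q m)
    rw [map_mul, map_mul, hmul, hmul, ← hqr]
    simp only [mul_assoc]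
  · rintro ⟨i, g, l⟩
    change φ₁ ⟨i, 1, l₁⟩ * (θ (inl i₁ i₂ l₁ l₂ g)).val * φ₁ ⟨i₁, 1, l⟩ = _
    simp [h₁, θ₁, ← map_mul, hl₁]
  · rintro ⟨i, g, l⟩
    change φ₂ ⟨i, 1, l₂⟩ * b * (θ (inr i₁ i₂ l₁ l₂ g)).val * (a * φ₂ ⟨i₂, 1, l⟩) = _
    simp only [h₂, θ₂, MonoidHom.mk'_apply, mul_assoc, hba']
    simp [f_def, ← map_mul, hl₂]

theorem ReesMatrix.free_hom_ext {S : Type*} [CSVariety S] (hl₁ : ∀ i, P₁ l₁ i = 1)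
    (hl₂ : ∀ i, P₂ l₂ i = 1)
    {ψ ψ' : ReesMatrix (freeSandwich i₁ i₂ l₁ l₂ P₁ P₂) →ₙ* S}
    (h₁ : ∀ x, ψ (freeInl i₁ i₂ l₁ l₂ P₁ P₂ x) = ψ' (freeInl i₁ i₂ l₁ l₂ P₁ P₂ x))
    (h₂ : ∀ x, ψ (freeInr i₁ i₂ l₁ l₂ P₁ P₂ x) = ψ' (freeInr i₁ i₂ l₁ l₂ P₁ P₂ x)) :
    ψ = ψ' := by
  have hmul : ∀ {x y}, ψ x = ψ' x → ψ y = ψ' y → ψ (x * y) = ψ' (x * y) := by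
    intro x y hx hy
    rw [map_mul, map_mul, hx, hy]
  have hinv : ∀ {x}, ψ x = ψ' x → ψ x⁻¹ = ψ' x⁻¹ := by
    intro x hx
    rw [CSVariety.map_inv, CSVariety.map_inv, hx]
  have b₁ : ∀ i l, ψ ⟨.inl i, 1, .inl l⟩ = ψ' ⟨.inl i, 1, .inl l⟩ := fun i l => by
    simpa [freeInl] using h₁ ⟨i, 1, l⟩
  have b₂ : ∀ i l, ψ ⟨.inr i, 1, .inr l⟩ = ψ' ⟨.inr i, 1, .inr l⟩ := fun i l => by
    simpa [freeInr] using h₂ ⟨i, 1, l⟩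
  -- Crossing from the second block to the first costs the lower base entry `1`. The crossing back
  -- in `b₁₂` costs the upper base generator, which is cancelled by an inverse.
  have b₂₁ : ∀ i, ψ ⟨.inr i, 1, .inl l₁⟩ = ψ' ⟨.inr i, 1, .inl l₁⟩ := fun i => by
    simpa [freeSandwich] using hmul (b₂ i l₂) (b₁ i₁ l₁)
  have b₁₂ : ∀ l, ψ ⟨.inl i₁, 1, .inr l⟩ = ψ' ⟨.inl i₁, 1, .inr l⟩ := fun l => by
    have := hmul (hinv (hmul (b₁ i₁ l₁) (b₂₁ i₂))) (b₂ i₂ l)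
    simpa [freeSandwich, hl₁] using this
  -- The equalizer of the two maps on the base maximal subgroup; it contains all generators.
  let H : Subgroup (StructureGroup G₁ G₂ i₁ i₂ l₁ l₂) :=
    { carrier := {g | ψ ⟨.inl i₁, g, .inl l₁⟩ = ψ' ⟨.inl i₁, g, .inl l₁⟩}
      mul_mem' := fun {g h} hg hh => by
        have := hmul hg hh
        simpa [freeSandwich, hl₁] using this
      one_mem' := b₁ i₁ l₁
      inv_mem' := fun {g} hg => by
        have := hinv hg
        simpa [freeSandwich, hl₁] using this }
  have hH : H = ⊤ := by
    refine subgroup_eq_top (fun g => h₁ ⟨i₁, g, l₁⟩) (fun g => ?_) (fun l i => ?_) fun l i => ?_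
    · change ψ _ = ψ' _
      have := hmul (hmul (b₁₂ l₂) (h₂ ⟨i₂, g, l₂⟩)) (b₂₁ i₂)
      simpa [freeSandwich, freeInr, hl₂] using this
    · change ψ _ = ψ' _
      have := hmul (b₁ i₁ l) (b₂₁ i)
      simpa [freeSandwich] using this
    · change ψ _ = ψ' _
      have := hmul (b₁₂ l) (b₁ i l₁)
      simpa [freeSandwich] using this
  ext ⟨i, g, l⟩
  have hg : ψ ⟨.inl i₁, g, .inl l₁⟩ = ψ' ⟨.inl i₁, g, .inl l₁⟩ :=
    show g ∈ H from hH ▸ Subgroup.mem_top g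
  have hr : ψ ⟨i, 1, .inl l₁⟩ = ψ' ⟨i, 1, .inl l₁⟩ := i.rec (fun i => b₁ i l₁) b₂₁
  have hc : ψ ⟨.inl i₁, 1, l⟩ = ψ' ⟨.inl i₁, 1, l⟩ := l.rec (b₁ i₁) b₁₂
  have := hmul (hmul hr hg) hc
  simpa [freeSandwich, hl₁] using this

end freeSandwich

/-! ### Identification of the free product and the conclusion. -/

section freeProduct

variable {G₁ G₂ : Type*} [Group G₁] [Group G₂] {I₁ I₂ Λ₁ Λ₂ : Type*} {i₁ : I₁} {i₂ : I₂}
  {l₁ : Λ₁} {l₂ : Λ₂} {P₁ : Λ₁ → I₁ → G₁} {P₂ : Λ₂ → I₂ → G₂} {S₁ : Type u} {S₂ : Type v}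
  [Semigroup S₁] [Semigroup S₂]

/-- The free product of two Rees matrix semigroups with normalized sandwich matrices is the Rees
matrix semigroup with sandwich matrix `freeSandwich`. -/
theorem CSFreeProduct.nonempty_mulEquiv (σ₁ : ReesMatrix P₁ ≃* S₁) (σ₂ : ReesMatrix P₂ ≃* S₂)
    (hl₁ : ∀ i, P₁ l₁ i = 1) (hl₂ : ∀ i, P₂ l₂ i = 1) :
    Nonempty (CSFreeProduct S₁ S₂ ≃* ReesMatrix (freeSandwich i₁ i₂ l₁ l₂ P₁ P₂)) := by
  have : Nonempty (ReesMatrix (freeSandwich i₁ i₂ l₁ l₂ P₁ P₂)) := ⟨⟨.inl i₁, 1, .inl l₁⟩⟩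
  have : Nonempty (CSFreeProduct S₁ S₂) := ⟨inl (σ₁ ⟨i₁, 1, l₁⟩)⟩
  obtain ⟨F, ⟨hF₁, hF₂⟩, -⟩ := existsUnique_lift
    (CSVariety.isCompletelySimple (S := ReesMatrix (freeSandwich i₁ i₂ l₁ l₂ P₁ P₂)))
    ((ReesMatrix.freeInl i₁ i₂ l₁ l₂ P₁ P₂).comp (σ₁.symm : S₁ →ₙ* ReesMatrix P₁))
    ((ReesMatrix.freeInr i₁ i₂ l₁ l₂ P₁ P₂).comp (σ₂.symm : S₂ →ₙ* ReesMatrix P₂))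
  obtain ⟨Θ, hΘ₁, hΘ₂⟩ := ReesMatrix.free_exists_lift hl₁ hl₂ (i₁ := i₁) (i₂ := i₂)
    ((inl (S₁ := S₁) (S₂ := S₂)).comp (σ₁ : ReesMatrix P₁ →ₙ* S₁))
    ((inr (S₁ := S₁) (S₂ := S₂)).comp (σ₂ : ReesMatrix P₂ →ₙ* S₂))
  -- Both objects have the universal property of the coproduct, so uniqueness makes `F` and `Θ`
  -- mutually inverse.
  have h₁ : Θ.comp F = MulHom.id _ := by
    refine (existsUnique_lift (CSVariety.isCompletelySimple (S := CSFreeProduct S₁ S₂))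
      inl inr).unique ⟨fun a => ?_, fun b => ?_⟩ ⟨fun _ => rfl, fun _ => rfl⟩
    · simp [hF₁, hΘ₁]
    · simp [hF₂, hΘ₂]
  have h₂ : F.comp Θ = MulHom.id _ := by
    refine ReesMatrix.free_hom_ext hl₁ hl₂ (fun x => ?_) fun x => ?_
    · simp [hF₁, hΘ₁]
    · simp [hF₂, hΘ₂]
  exact ⟨MulHom.toMulEquiv F Θ h₁ h₂⟩

theorem CSFreeProduct.isEquationalDomain_of_rees (σ₁ : ReesMatrix P₁ ≃* S₁)
    (σ₂ : ReesMatrix P₂ ≃* S₂) (hl₁ : ∀ i, P₁ l₁ i = 1) (hi₁ : ∀ l, P₁ l i₁ = 1)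
    (hl₂ : ∀ i, P₂ l₂ i = 1) (hi₂ : ∀ l, P₂ l i₂ = 1) (hne : Nontrivial S₁ ∨ Nontrivial S₂) :
    IsEquationalDomain (CSFreeProduct S₁ S₂) := by
  obtain ⟨φ⟩ := nonempty_mulEquiv σ₁ σ₂ hl₁ hl₂ (i₁ := i₁) (i₂ := i₂)
  have h₀ : freeSandwich i₁ i₂ l₁ l₂ P₁ P₂ (.inl l₁) (.inl i₁) = 1 := by
    simp [freeSandwich, hl₁]
  have hG : GroupNoZeroDivisors (StructureGroup G₁ G₂ i₁ i₂ l₁ l₂) := by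
    refine StructureGroup.noZeroDivisors _ _ _ _ ?_
    -- Otherwise both groups are trivial and, since the two off-diagonal blocks have only their base
    -- entries, all four index sets are singletons; both factors would then have one element.
    by_contra! h
    obtain ⟨hG₁, hG₂, hX⟩ := h
    have upper : ∀ q : Λ₁ × I₂, q = (l₁, i₂) := fun q =>
      by_contra fun hq => hX.false (.inl ⟨q, hq⟩)
    have lower : ∀ q : Λ₂ × I₁, q = (l₂, i₁) := fun q =>
      by_contra fun hq => hX.false (.inr ⟨q, hq⟩)
    rcases hne with hne | hne
    · obtain ⟨x, y, hxy⟩ := σ₁.nontrivial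
      exact hxy (ReesMatrix.ext
        (congrArg Prod.snd ((lower (l₂, x.row)).trans (lower (l₂, y.row)).symm))
        (Subsingleton.elim _ _)
        (congrArg Prod.fst ((upper (x.col, i₂)).trans (upper (y.col, i₂)).symm)))
    · obtain ⟨x, y, hxy⟩ := σ₂.nontrivial
      exact hxy (ReesMatrix.ext
        (congrArg Prod.snd ((upper (l₁, x.row)).trans (upper (l₁, y.row)).symm))
        (Subsingleton.elim _ _)
        (congrArg Prod.fst ((lower (x.col, i₁)).trans (lower (y.col, i₁)).symm)))
  refine isEquationalDomain_of_noZeroDivisorsAt (e := φ.symm ⟨.inl i₁, 1, .inl l₁⟩) ?_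
    (.of_mulEquiv φ (freeSandwich_separatedByTranslations hl₁ hi₁ hl₂ hi₂))
    (.of_mulEquiv φ ?_)
  · rw [← map_mul]
    simp [h₀]
  · rw [φ.apply_symm_apply]
    exact ReesMatrix.noZeroDivisorsAt hG h₀

end freeProduct

theorem CSVariety.exists_idempotent {S : Type u} [CSVariety S] [hS : Nonempty S] :
    ∃ e : S, e * e = e := by
  obtain ⟨x⟩ := hS
  exact ⟨x * x⁻¹, by rw [← mul_assoc, mul_inv_mul]⟩

theorem IsCompletelySimple.nonempty {S : Type u} [Semigroup S] (h : IsCompletelySimple S) :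
    Nonempty S := by
  obtain ⟨L, hL, -⟩ := h.exists_minimal_left
  exact hL.1.to_type

theorem mainTheorem4 {S₁ : Type u} {S₂ : Type v} [Semigroup S₁] [Semigroup S₂]
    (h₁ : IsCompletelySimple S₁) (h₂ : IsCompletelySimple S₂)
    (hne : Nontrivial S₁ ∨ Nontrivial S₂) :
    IsCompletelySimple (CSFreeProduct S₁ S₂) ∧ IsEquationalDomain (CSFreeProduct S₁ S₂) := by
  refine ⟨CSFreeProduct.isCompletelySimple h₁, ?_⟩
  have := h₁.nonempty
  have := h₂.nonempty
  obtain ⟨V₁, rfl⟩ := h₁.exists_csVariety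
  obtain ⟨V₂, rfl⟩ := h₂.exists_csVariety
  obtain ⟨e₁, he₁⟩ := CSVariety.exists_idempotent (S := S₁)
  obtain ⟨e₂, he₂⟩ := CSVariety.exists_idempotent (S := S₂)
  let _ := MaximalSubgroup.group he₁
  let _ := MaximalSubgroup.group he₂
  exact CSFreeProduct.isEquationalDomain_of_rees (reesMulEquiv he₁) (reesMulEquiv he₂)
    (sandwich_base_left he₁) (sandwich_base_right he₁) (sandwich_base_left he₂)
    (sandwich_base_right he₂) hne
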